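/- Let $n\ge 0$ and let $\mathfrak S_n(312)$ be the set of permutations $\sigma$ of $\{1,\dots,n\}$ that avoid the pattern $312$, i.e. for which there are no $i<j<k$ with $\sigma(j)<\sigma(k)<\sigma(i)$. For a permutation $\sigma$ of $\{1,\dots,n\}$ let $\mathrm{maj}(\sigma)$ be its major index, the sum of all $j$ with $1\le j\le n-1$ and $\sigma(j)>\sigma(j+1)$, and put $$\mathcal A(q,t)=\sum_{\sigma\in\mathfrak S_n(312)}q^{\mathrm{maj}(\sigma)}\,t^{\mathrm{maj}(\sigma^{-1})}\in\mathbb Z[q,t].$$ Then, as an identity of rational functions in the indeterminate $q$ (over $\mathbb Q$), $$\mathcal A(q,q)=\frac{1}{[n+1]}\genfrac{[}{]}{0pt}{}{2n}{n},$$ where $[m]=\sum_{i=0}^{m-1}q^i$, $\genfrac{[}{]}{0pt}{}{m}{k}=\frac{(q)_m}{(q)_k(q)_{m-k}}$ for $0\le k\le m$, and $(q)_m=(1-q)(1-q^2)\cdots(1-q^m)$. -/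

import Mathlib

namespace QCatalan

/-- The `q`-integer `[n] = 1 + q + ⋯ + q^(n-1)`. -/
def qInt {R : Type*} [CommRing R] (q : R) (n : ℕ) : R :=
  ∑ i ∈ Finset.range n, q ^ i

/-- The `q`-shifted factorial `(x; q)_n = (1 - x)(1 - q x) ⋯ (1 - q^(n-1) x)`. -/
def qPochhammer {R : Type*} [CommRing R] (x q : R) (n : ℕ) : R :=
  ∏ i ∈ Finset.range n, (1 - q ^ i * x)

/-- The Gaussian binomial `(q; q)_n / ((q; q)_k (q; q)_(n-k))`, for `k ≤ n`
and `q` not a root of unity (in the theorem, `q` is an indeterminate). -/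
def qBinom {K : Type*} [Field K] (q : K) (n k : ℕ) : K :=
  qPochhammer q q n / (qPochhammer q q k * qPochhammer q q (n - k))

/-- Descents of a finite sequence. The index `j : Fin n` stands for the position `j + 1`. -/
def descents {α : Type*} [LinearOrder α] {n : ℕ} (f : Fin n → α) : Finset (Fin n) :=
  Finset.univ.filter fun j => ∃ h : (j : ℕ) + 1 < n, f ⟨(j : ℕ) + 1, h⟩ < f j

/-- The major index: the sum of the descent positions, counted from `1`. -/
def maj {α : Type*} [LinearOrder α] {n : ℕ} (f : Fin n → α) : ℕ :=
  ∑ j ∈ descents f, ((j : ℕ) + 1)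

/-- `σ` is `312`-avoiding: there are no `i < j < k` with `σ j < σ k < σ i`. -/
def Avoids312 {n : ℕ} (σ : Equiv.Perm (Fin n)) : Prop :=
  ∀ i j k : Fin n, i < j → j < k → ¬ (σ j < σ k ∧ σ k < σ i)

instance {n : ℕ} : DecidablePred (Avoids312 (n := n)) := fun σ =>
  inferInstanceAs
    (Decidable (∀ i j k : Fin n, i < j → j < k → ¬ (σ j < σ k ∧ σ k < σ i)))

/-- The polynomial `A(q, t) = ∑ q^(maj σ) t^(maj σ⁻¹)` over the `312`-avoiding permutations `σ`
of `n` letters; `q` is the variable `0` and `t` is the variable `1`. -/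
noncomputable def genFun (n : ℕ) : MvPolynomial (Fin 2) ℤ :=
  ∑ σ : Equiv.Perm (Fin n) with Avoids312 σ,
    MvPolynomial.X 0 ^ maj σ * MvPolynomial.X 1 ^ maj (σ⁻¹ : Equiv.Perm (Fin n))

end QCatalan

/-!
Every `312`-avoiding permutation of `n + 2` letters arises uniquely from one of `n + 1` letters by
inserting a new largest letter. The letters from the old maximum on are decreasing, and the
insertion keeps avoidance exactly when the new letter goes directly before the old maximum or
anywhere after it. Inserting it at position `p` (counted from `0`) adds `n + 1` to the set of
descent positions and then deletes `p`, while the inverse word only gets a last letter appended,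
up to an increasing relabelling. So if `j` letters follow the new maximum, `maj σ + maj σ⁻¹` grows
by `j`, except that it grows by `2 (n + 1)` when the new letter stands directly before the old
maximum.

Refining by the number `j` of letters after the maximum turns this into a linear recursion, which
is solved by a `q`-ballot number, a difference of two Gaussian binomials; the verification is the
`q`-Pascal rule and summation by parts. Summing over `j` telescopes to MacMahon's form
`[2n choose n] - q [2n choose n + 1]` of the `q`-Catalan number. Taking the Gaussian binomials from
the `q`-Pascal recursion keeps all of this free of division.
-/

namespace QCatalan

section Descents

lemma strictAntiOn_insertNth {α : Type*} [Preorder α] {n : ℕ} {f : Fin n → α} {a : α}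
    {p : Fin (n + 1)} (ha : ∀ i, f i < a) (hf : StrictAntiOn f {i | (p : ℕ) ≤ i}) :
    StrictAntiOn (p.insertNth a f : Fin (n + 1) → α) {i | (p : ℕ) ≤ i} := by
  intro x (hx : p ≤ x) y (hy : p ≤ y) hxy
  obtain rfl | ⟨y, rfl⟩ := p.eq_self_or_eq_succAbove y
  · exact absurd hx hxy.not_ge
  rw [Fin.insertNth_apply_succAbove]
  obtain rfl | ⟨x, rfl⟩ := p.eq_self_or_eq_succAbove x
  · rw [Fin.insertNth_apply_same]
    exact ha y
  · rw [Fin.insertNth_apply_succAbove]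
    have le_of_le_succAbove {i : Fin n} (hi : p ≤ p.succAbove i) : p ≤ i.castSucc :=
      (Fin.lt_succAbove_iff_le_castSucc p i).1 (hi.lt_of_ne (Fin.succAbove_ne p i).symm)
    exact hf (le_of_le_succAbove hx) (le_of_le_succAbove hy) (Fin.succAbove_lt_succAbove_iff.1 hxy)

variable {α β : Type*} [LinearOrder α] [LinearOrder β] {n : ℕ}

lemma descents_comp_strictMono {g : α → β} (hg : StrictMono g) (f : Fin n → α) :
    descents (g ∘ f) = descents f := by
  simp only [descents, Function.comp_apply, hg.lt_iff_lt]

lemma maj_comp_strictMono {g : α → β} (hg : StrictMono g) (f : Fin n → α) :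
    maj (g ∘ f) = maj f := by
  rw [maj, maj, descents_comp_strictMono hg]

lemma maj_eq_sum_ite (f : Fin (n + 1) → α) :
    maj f = ∑ i : Fin n, if f i.succ < f i.castSucc then (i : ℕ) + 1 else 0 := by
  rw [maj, descents, Finset.sum_filter, Fin.sum_univ_castSucc]
  simp [Fin.succ]

lemma maj_snoc (f : Fin (n + 1) → α) (a : α) :
    maj (Fin.snoc f a : Fin (n + 2) → α) = maj f + if a < f (Fin.last n) then n + 1 else 0 := by
  rw [maj_eq_sum_ite, maj_eq_sum_ite, Fin.sum_univ_castSucc]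
  simp only [← Fin.castSucc_succ, Fin.snoc_castSucc, Fin.succ_last, Fin.snoc_last, Fin.val_castSucc,
    Fin.val_last]

/-- The set of descent positions of a sequence, counted from `1` as in the major index. -/
def descentPositions (f : Fin n → α) : Finset ℕ :=
  (descents f).image fun j : Fin n => (j : ℕ) + 1

lemma maj_eq_sum_descentPositions (f : Fin n → α) : maj f = ∑ d ∈ descentPositions f, d := by
  rw [descentPositions, Finset.sum_image fun _ _ _ _ h => Fin.ext (Nat.succ.inj h), maj]

lemma mem_descentPositions {f : Fin (n + 1) → α} {d : ℕ} :
    d ∈ descentPositions f ↔ ∃ i : Fin n, f i.succ < f i.castSucc ∧ (i : ℕ) + 1 = d := by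
  simp [descentPositions, descents, Fin.exists_fin_succ', Fin.exists_iff, Fin.succ]

lemma val_succ_mem_descentPositions {f : Fin (n + 1) → α} {i : Fin n} :
    (i : ℕ) + 1 ∈ descentPositions f ↔ f i.succ < f i.castSucc := by
  simp [mem_descentPositions, ← Fin.ext_iff]

lemma zero_notMem_descentPositions (f : Fin n → α) : 0 ∉ descentPositions f := by
  simp [descentPositions]

lemma lt_of_mem_descentPositions {f : Fin n → α} {d : ℕ} (hd : d ∈ descentPositions f) : d < n := by
  obtain ⟨j, hj, rfl⟩ := Finset.mem_image.1 hd
  obtain ⟨h, -⟩ := (Finset.mem_filter.1 hj).2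
  exact h

lemma mem_descentPositions_iff_le {f : Fin (n + 1) → α} {p d : ℕ}
    (hf : StrictAntiOn f {i | p ≤ (i : ℕ)}) (hpd : p < d) : d ∈ descentPositions f ↔ d ≤ n := by
  refine ⟨fun h => Nat.lt_succ_iff.1 (lt_of_mem_descentPositions h), fun hdn => ?_⟩
  obtain ⟨k, rfl⟩ := Nat.exists_eq_succ_of_ne_zero (Nat.ne_zero_of_lt hpd)
  let i : Fin n := ⟨k, hdn⟩
  have hpi : p ≤ (i : ℕ) := Nat.lt_succ_iff.1 hpd
  exact val_succ_mem_descentPositions.2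
    (hf (a := i.castSucc) (b := i.succ) hpi (Nat.le_succ_of_le hpi) i.castSucc_lt_succ)

lemma mem_descentPositions_insertNth_of_lt {f : Fin (n + 1) → α} {a : α} {p : Fin (n + 2)} {d : ℕ}
    (hd : d < p) :
    d ∈ descentPositions (p.insertNth a f : Fin (n + 2) → α) ↔ d ∈ descentPositions f := by
  rcases d with - | k
  · simp only [zero_notMem_descentPositions]
  let i : Fin n := ⟨k, by omega⟩
  have hsucc : p.succAbove i.succ = i.castSucc.succ :=
    Fin.succAbove_of_castSucc_lt p i.succ hd
  have hcast : p.succAbove i.castSucc = i.castSucc.castSucc :=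
    Fin.succAbove_of_castSucc_lt p i.castSucc (Nat.lt_of_succ_lt hd)
  change (i.castSucc : ℕ) + 1 ∈ _ ↔ (i : ℕ) + 1 ∈ _
  rw [val_succ_mem_descentPositions, val_succ_mem_descentPositions, ← hsucc, ← hcast,
    Fin.insertNth_apply_succAbove, Fin.insertNth_apply_succAbove]

lemma notMem_descentPositions_of_forall_le {f : Fin (n + 1) → α} {p : Fin (n + 1)}
    (hp : ∀ i, f i ≤ f p) : (p : ℕ) ∉ descentPositions f := by
  rw [mem_descentPositions]
  rintro ⟨i, hi, hip⟩
  obtain rfl : i.succ = p := Fin.ext hip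
  exact hi.not_ge (hp _)

lemma descentPositions_insertNth {f : Fin (n + 1) → α} {a : α} {p : Fin (n + 2)}
    (ha : ∀ i, f i < a) (hf : StrictAntiOn f {i | (p : ℕ) ≤ i}) :
    descentPositions (p.insertNth a f : Fin (n + 2) → α) =
      (insert (n + 1) (descentPositions f)).erase p := by
  ext d
  rw [Finset.mem_erase, Finset.mem_insert]
  rcases lt_trichotomy d p with hd | rfl | hd
  · rw [mem_descentPositions_insertNth_of_lt hd]
    have : d ≠ p ∧ d ≠ n + 1 := by omega
    tauto
  · have hmax : (p : ℕ) ∉ descentPositions (p.insertNth a f : Fin (n + 2) → α) :=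
      notMem_descentPositions_of_forall_le (by simp [p.forall_iff_succAbove, (ha _).le])
    simp only [hmax, ne_eq, not_true_eq_false, false_and]
  · rw [mem_descentPositions_iff_le (strictAntiOn_insertNth ha hf) hd,
      mem_descentPositions_iff_le hf hd]
    omega

lemma maj_insertNth {f : Fin (n + 1) → α} {a : α} {p : Fin (n + 2)}
    (ha : ∀ i, f i < a) (hf : StrictAntiOn f {i | (p : ℕ) ≤ i}) :
    maj (p.insertNth a f : Fin (n + 2) → α) +
        (if (p : ℕ) ∈ insert (n + 1) (descentPositions f) then (p : ℕ) else 0) =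
      maj f + (n + 1) := by
  have hn : n + 1 ∉ descentPositions f := fun h => (lt_of_mem_descentPositions h).false
  rw [maj_eq_sum_descentPositions, descentPositions_insertNth ha hf, maj_eq_sum_descentPositions,
    add_comm _ (n + 1), ← Finset.sum_insert (f := fun d => d) hn]
  split_ifs with hp
  · exact Finset.sum_erase_add _ _ hp
  · rw [Finset.erase_eq_of_notMem hp, add_zero]

end Descents

section InsertMax

variable {n : ℕ}

/-- Insert a new maximum into the word of `σ` so that it becomes the letter at position `p`. -/
def insertMax (p : Fin (n + 1)) (σ : Equiv.Perm (Fin n)) : Equiv.Perm (Fin (n + 1)) :=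
  (finSuccEquiv' p).trans (σ.optionCongr.trans finSuccEquivLast.symm)

@[simp]
lemma insertMax_self (p : Fin (n + 1)) (σ : Equiv.Perm (Fin n)) :
    insertMax p σ p = Fin.last n := by
  simp [insertMax]

@[simp]
lemma insertMax_succAbove (p : Fin (n + 1)) (σ : Equiv.Perm (Fin n)) (i : Fin n) :
    insertMax p σ (p.succAbove i) = (σ i).castSucc := by
  simp [insertMax]

lemma coe_insertMax (p : Fin (n + 1)) (σ : Equiv.Perm (Fin n)) :
    ⇑(insertMax p σ) = p.insertNth (Fin.last n) (Fin.castSucc ∘ σ) := by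
  rw [Fin.eq_insertNth_iff]
  exact ⟨insertMax_self p σ, funext (insertMax_succAbove p σ)⟩

@[simp]
lemma insertMax_inv_last (p : Fin (n + 1)) (σ : Equiv.Perm (Fin n)) :
    (insertMax p σ)⁻¹ (Fin.last n) = p := by
  rw [Equiv.Perm.inv_eq_iff_eq, insertMax_self]

lemma coe_insertMax_inv (p : Fin (n + 1)) (σ : Equiv.Perm (Fin n)) :
    ⇑(insertMax p σ)⁻¹ = Fin.snoc (p.succAbove ∘ ⇑σ⁻¹) p := by
  refine funext (Fin.lastCases ?_ fun i => ?_)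
  · rw [insertMax_inv_last, Fin.snoc_last]
  · rw [Fin.snoc_castSucc, Equiv.Perm.inv_eq_iff_eq, Function.comp_apply, insertMax_succAbove,
      show σ (σ⁻¹ i) = i from σ.apply_symm_apply i]

lemma insertMax_bijective : Function.Bijective fun x : Fin (n + 1) × Equiv.Perm (Fin n) =>
    insertMax x.1 x.2 := by
  rw [Fintype.bijective_iff_injective_and_card]
  refine ⟨?_, by simp [Fintype.card_perm, Nat.factorial_succ]⟩
  rintro ⟨p, σ⟩ ⟨p', σ'⟩ (h : insertMax p σ = insertMax p' σ')
  obtain rfl : p = p' := by rw [← insertMax_inv_last p σ, h, insertMax_inv_last]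
  obtain rfl : σ = σ' := Equiv.ext fun i => Fin.castSucc_injective n <| by
    rw [← insertMax_succAbove p, h, insertMax_succAbove]
  rfl

lemma avoids312_insertMax_iff_strictAntiOn (p : Fin (n + 1)) (σ : Equiv.Perm (Fin n)) :
    Avoids312 (insertMax p σ) ↔ Avoids312 σ ∧ StrictAntiOn σ {i | (p : ℕ) ≤ i} := by
  have hmono := Fin.strictMono_succAbove p
  constructor
  · refine fun h => ⟨fun i j k hij hjk hσ => ?_, fun j hj k _ hjk => ?_⟩
    · refine h _ _ _ (hmono hij) (hmono hjk) ?_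
      simpa only [insertMax_succAbove, Fin.castSucc_lt_castSucc_iff] using hσ
    · by_contra! hle
      refine h p _ _ ((Fin.lt_succAbove_iff_le_castSucc p j).2 hj) (hmono hjk) ?_
      rw [insertMax_self, insertMax_succAbove, insertMax_succAbove, Fin.castSucc_lt_castSucc_iff]
      exact ⟨hle.lt_of_ne (σ.injective.ne hjk.ne), Fin.castSucc_lt_last _⟩
  · rintro ⟨hσ, hanti⟩ i j k hij hjk ⟨hvjk, hvki⟩
    have ne_of_lt {x y : Fin (n + 1)} (h : insertMax p σ x < insertMax p σ y) : x ≠ p := by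
      rintro rfl
      exact (insertMax_self x σ ▸ h).not_ge (Fin.le_last _)
    obtain ⟨j, rfl⟩ := Fin.exists_succAbove_eq (ne_of_lt hvjk)
    obtain ⟨k, rfl⟩ := Fin.exists_succAbove_eq (ne_of_lt hvki)
    rw [hmono.lt_iff_lt] at hjk
    rw [insertMax_succAbove, insertMax_succAbove, Fin.castSucc_lt_castSucc_iff] at hvjk
    obtain rfl | ⟨i, rfl⟩ := p.eq_self_or_eq_succAbove i
    · have hj : i ≤ j.castSucc := (Fin.lt_succAbove_iff_le_castSucc i j).1 hij
      exact (hanti hj (hj.trans (Fin.castSucc_le_castSucc_iff.2 hjk.le)) hjk).not_gt hvjk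
    · rw [insertMax_succAbove, insertMax_succAbove, Fin.castSucc_lt_castSucc_iff] at hvki
      exact hσ i j k (hmono.lt_iff_lt.1 hij) hjk ⟨hvjk, hvki⟩

lemma apply_inv_last (σ : Equiv.Perm (Fin (n + 1))) : σ (σ⁻¹ (Fin.last n)) = Fin.last n :=
  σ.apply_symm_apply _

lemma apply_le_apply_inv_last (σ : Equiv.Perm (Fin (n + 1))) (i : Fin (n + 1)) :
    σ i ≤ σ (σ⁻¹ (Fin.last n)) :=
  (Fin.le_last _).trans_eq (apply_inv_last σ).symm

lemma Avoids312.strictAntiOn {σ : Equiv.Perm (Fin (n + 1))} (hσ : Avoids312 σ) :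
    StrictAntiOn σ (Set.Ici (σ⁻¹ (Fin.last n))) := by
  intro i hi j _ hij
  by_contra! hle
  have hlt : σ i < σ j := hle.lt_of_ne (σ.injective.ne hij.ne)
  have hmi : σ⁻¹ (Fin.last n) < i := by
    refine lt_of_le_of_ne hi ?_
    rintro rfl
    exact hlt.not_ge (apply_le_apply_inv_last σ j)
  have hjm : σ j < σ (σ⁻¹ (Fin.last n)) := by
    refine lt_of_le_of_ne (apply_le_apply_inv_last σ j) (σ.injective.ne ?_)
    exact (hmi.trans hij).ne'
  exact hσ _ i j hmi hij ⟨hlt, hjm⟩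

lemma Avoids312.strictAntiOn_iff {σ : Equiv.Perm (Fin (n + 1))} (hσ : Avoids312 σ) (p : ℕ) :
    StrictAntiOn σ {i | p ≤ (i : ℕ)} ↔ (σ⁻¹ (Fin.last n) : ℕ) ≤ p := by
  refine ⟨fun h => ?_, fun hp => hσ.strictAntiOn.mono fun i hi => hp.trans hi⟩
  by_contra! hp
  have := h (a := ⟨p, hp.trans (Fin.is_lt _)⟩) (le_refl p) hp.le hp
  rw [apply_inv_last] at this
  exact this.not_ge (Fin.le_last _)

lemma avoids312_insertMax_iff (p : Fin (n + 2)) (σ : Equiv.Perm (Fin (n + 1))) :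
    Avoids312 (insertMax p σ) ↔ Avoids312 σ ∧ (σ⁻¹ (Fin.last n) : ℕ) ≤ p :=
  (avoids312_insertMax_iff_strictAntiOn p σ).trans
    (and_congr_right fun hσ => hσ.strictAntiOn_iff p)

lemma maj_insertMax {p : Fin (n + 2)} {σ : Equiv.Perm (Fin (n + 1))} (hσ : Avoids312 σ)
    (hp : (σ⁻¹ (Fin.last n) : ℕ) ≤ p) :
    maj (insertMax p σ) =
      maj σ + if (p : ℕ) = (σ⁻¹ (Fin.last n) : ℕ) then n + 1 else (p.rev : ℕ) := by
  have hanti := (hσ.strictAntiOn_iff p).2 hp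
  have hmaj := maj_insertNth (f := Fin.castSucc ∘ σ) (fun i => (σ i).castSucc_lt_last)
    (Fin.strictMono_castSucc.comp_strictAntiOn hanti)
  rw [← coe_insertMax, maj_comp_strictMono Fin.strictMono_castSucc, descentPositions,
    descents_comp_strictMono Fin.strictMono_castSucc, ← descentPositions] at hmaj
  have hmem : (p : ℕ) ∈ insert (n + 1) (descentPositions σ) ↔ (p : ℕ) ≠ σ⁻¹ (Fin.last n) := by
    rw [Finset.mem_insert]
    rcases hp.eq_or_lt with heq | hlt
    · have := notMem_descentPositions_of_forall_le (f := σ) (p := σ⁻¹ (Fin.last n))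
        (apply_le_apply_inv_last σ)
      simp only [← heq, this, or_false, ne_eq, not_true_eq_false, iff_false]
      omega
    · rw [mem_descentPositions_iff_le ((hσ.strictAntiOn_iff _).2 le_rfl) hlt]
      omega
  rw [Fin.val_rev]
  simp only [hmem, ne_eq, ite_not] at hmaj
  split_ifs at hmaj ⊢ <;> omega

lemma maj_insertMax_inv {p : Fin (n + 2)} {σ : Equiv.Perm (Fin (n + 1))}
    (hp : (σ⁻¹ (Fin.last n) : ℕ) ≤ p) :
    maj ⇑(insertMax p σ)⁻¹ =
      maj ⇑σ⁻¹ + if (p : ℕ) = (σ⁻¹ (Fin.last n) : ℕ) then n + 1 else 0 := by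
  have hdesc : p < p.succAbove (σ⁻¹ (Fin.last n)) ↔ (p : ℕ) = (σ⁻¹ (Fin.last n) : ℕ) :=
    (Fin.lt_succAbove_iff_le_castSucc _ _).trans ⟨fun h => le_antisymm h hp, fun h => h.le⟩
  rw [coe_insertMax_inv, maj_snoc, maj_comp_strictMono (Fin.strictMono_succAbove p)]
  simp only [Function.comp_apply, hdesc]

end InsertMax

section GaussBinom

variable {R : Type*} [CommRing R]

/-- The Gaussian binomial as a polynomial in `q`, given by the `q`-Pascal recursion; unlike `qBinom`
it makes sense over any commutative ring, and it vanishes for `n < k`. -/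
def gaussBinom (q : R) : ℕ → ℕ → R
  | _, 0 => 1
  | 0, _ + 1 => 0
  | n + 1, k + 1 => gaussBinom q n k + q ^ (k + 1) * gaussBinom q n (k + 1)

lemma qInt_add (q : R) (m n : ℕ) : qInt q (m + n) = qInt q m + q ^ m * qInt q n := by
  simp only [qInt, Finset.sum_range_add, pow_add, Finset.mul_sum]

lemma qInt_mul_one_sub (q : R) (n : ℕ) : qInt q n * (1 - q) = 1 - q ^ n :=
  geom_sum_mul_neg q n

lemma qPochhammer_self_succ (q : R) (n : ℕ) :
    qPochhammer q q (n + 1) = qPochhammer q q n * (1 - q ^ (n + 1)) := by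
  rw [qPochhammer, Finset.prod_range_succ, pow_succ, qPochhammer]

@[simp]
lemma gaussBinom_zero_right (q : R) (n : ℕ) : gaussBinom q n 0 = 1 := by
  cases n <;> rfl

lemma gaussBinom_succ_succ (q : R) (n k : ℕ) :
    gaussBinom q (n + 1) (k + 1) = gaussBinom q n k + q ^ (k + 1) * gaussBinom q n (k + 1) := rfl

lemma gaussBinom_eq_zero_of_lt (q : R) {n k : ℕ} (h : n < k) : gaussBinom q n k = 0 := by
  induction n generalizing k with
  | zero => obtain ⟨k, rfl⟩ := Nat.exists_eq_add_of_lt h; rw [zero_add]; rfl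
  | succ n ih =>
    obtain ⟨k, rfl⟩ := Nat.exists_eq_succ_of_ne_zero (Nat.ne_zero_of_lt h)
    rw [gaussBinom_succ_succ, ih (by omega), ih (by omega), mul_zero, add_zero]

@[simp]
lemma gaussBinom_self (q : R) (n : ℕ) : gaussBinom q n n = 1 := by
  induction n with
  | zero => rfl
  | succ n ih =>
    rw [gaussBinom_succ_succ, ih, gaussBinom_eq_zero_of_lt q n.lt_succ_self, mul_zero, add_zero]

lemma qInt_succ_mul_gaussBinom_succ (q : R) (k a : ℕ) :
    qInt q (k + 1) * gaussBinom q (k + a) (k + 1) = qInt q a * gaussBinom q (k + a) k := by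
  induction hn : k + a generalizing k a with
  | zero => obtain ⟨rfl, rfl⟩ := Nat.add_eq_zero_iff.1 hn; simp [gaussBinom, qInt]
  | succ n ih =>
    rcases a with - | a
    · rw [gaussBinom_eq_zero_of_lt q (by omega)]
      simp [qInt]
    have absorb : qInt q (a + 1) * gaussBinom q (n + 1) k = qInt q (n + 1) * gaussBinom q n k := by
      rcases k with - | k
      · rw [gaussBinom_zero_right, gaussBinom_zero_right, ← hn, zero_add]
      · have hsplit := qInt_add q (k + 1) (a + 1)
        rw [hn] at hsplit
        rw [gaussBinom_succ_succ]
        linear_combination -ih k (a + 1) (by omega) - gaussBinom q n (k + 1) * hsplit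
    have hsplit := qInt_add q (k + 1) a
    rw [show k + 1 + a = n + 1 by omega] at hsplit
    rw [absorb, gaussBinom_succ_succ]
    linear_combination q ^ (k + 1) * ih k a (by omega) - gaussBinom q n k * hsplit

lemma gaussBinom_add_succ_succ (q : R) (k a : ℕ) :
    gaussBinom q (k + a + 1) (k + 1) =
      q ^ a * gaussBinom q (k + a) k + gaussBinom q (k + a) (k + 1) := by
  have hk := qInt_mul_one_sub q (k + 1)
  have ha := qInt_mul_one_sub q a
  rw [gaussBinom_succ_succ]
  -- The two `q`-Pascal rules differ by `q - 1` times the absorption identity.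
  linear_combination (q - 1) * qInt_succ_mul_gaussBinom_succ q k a +
    gaussBinom q (k + a) (k + 1) * hk - gaussBinom q (k + a) k * ha

lemma gaussBinom_symm_add (q : R) (a b : ℕ) : gaussBinom q (a + b) a = gaussBinom q (a + b) b := by
  induction hn : a + b generalizing a b with
  | zero => obtain ⟨rfl, rfl⟩ := Nat.add_eq_zero_iff.1 hn; rfl
  | succ n ih =>
    rcases a with - | a
    · rw [gaussBinom_zero_right, ← hn, zero_add, gaussBinom_self]
    rcases b with - | b
    · rw [gaussBinom_zero_right, ← hn, add_zero, gaussBinom_self]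
    have hb := gaussBinom_add_succ_succ q b (a + 1)
    rw [show b + (a + 1) = n by omega] at hb
    rw [hb, gaussBinom_succ_succ, ih a (b + 1) (by omega), ih (a + 1) b (by omega), add_comm]

lemma gaussBinom_mul_qPochhammer (q : R) (k a : ℕ) :
    gaussBinom q (k + a) k * (qPochhammer q q k * qPochhammer q q a) = qPochhammer q q (k + a) := by
  induction k generalizing a with
  | zero => simp [qPochhammer]
  | succ k ih =>
    have absorb : gaussBinom q (k + 1 + a) (k + 1) * (1 - q ^ (k + 1)) =
        gaussBinom q (k + (a + 1)) k * (1 - q ^ (a + 1)) := by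
      rw [← qInt_mul_one_sub, ← qInt_mul_one_sub, add_right_comm, ← add_assoc]
      linear_combination (1 - q) * qInt_succ_mul_gaussBinom_succ q k (a + 1)
    rw [add_right_comm, add_assoc, ← ih (a + 1), qPochhammer_self_succ, qPochhammer_self_succ]
    rw [add_right_comm, add_assoc] at absorb
    linear_combination qPochhammer q q k * qPochhammer q q a * absorb

/-- The MacMahon form of the `q`-Catalan number: it equals `[n+1]⁻¹ [2n choose n]`, but is visibly
polynomial in `q`. -/
def qCatalan (q : R) (n : ℕ) : R :=
  gaussBinom q (2 * n) n - q * gaussBinom q (2 * n) (n + 1)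

lemma qInt_succ_mul_qCatalan (q : R) (n : ℕ) :
    qInt q (n + 1) * qCatalan q n = gaussBinom q (2 * n) n := by
  have h := qInt_succ_mul_gaussBinom_succ q n n
  have hsucc : qInt q (n + 1) = 1 + q * qInt q n := by
    rw [add_comm, qInt_add]; simp [qInt]
  rw [← two_mul] at h
  rw [qCatalan]
  linear_combination gaussBinom q (2 * n) n * hsucc - q * h

lemma qBinom_add_left {K : Type*} [Field K] {q : K} {k a : ℕ} (hk : qPochhammer q q k ≠ 0)
    (ha : qPochhammer q q a ≠ 0) : qBinom q (k + a) k = gaussBinom q (k + a) k := by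
  rw [qBinom, Nat.add_sub_cancel_left, ← gaussBinom_mul_qPochhammer,
    mul_div_cancel_right₀ _ (mul_ne_zero hk ha)]

end GaussBinom

section Ballot

variable {R : Type*} [CommRing R]

/-- The `q`-ballot number: the sum of `q ^ (maj σ + maj σ⁻¹)` over the `312`-avoiding permutations
`σ` of `n + 1` letters with exactly `j` letters after the largest one, see `avoiderSum_eq`. It is
meaningful for `j ≤ n`, where the subtraction is not truncated. -/
def qBallot (q : R) (n j : ℕ) : R :=
  q ^ ((n + 1) * j) * (gaussBinom q (2 * n - j) n - q ^ (j + 1) * gaussBinom q (2 * n - j) (n + 1))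

/-- The closed form of the sum of the `q`-ballot numbers `qBallot q n i` over `j ≤ i ≤ n`, meant
for `j ≤ n + 1`. -/
def qBallotTail (q : R) (n j : ℕ) : R :=
  q ^ ((n + 1) * j) *
    (gaussBinom q (2 * n + 1 - j) (n + 1) - q ^ (j + 1) * gaussBinom q (2 * n + 1 - j) (n + 2))

lemma qBallot_zero_right (q : R) (n : ℕ) : qBallot q n 0 = qCatalan q n := by
  rw [qBallot, qCatalan, mul_zero, pow_zero, one_mul, Nat.sub_zero, zero_add, pow_one]

lemma qBallotTail_sub_qBallotTail_succ (q : R) {n j : ℕ} (h : j ≤ 2 * n) :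
    qBallotTail q n j - qBallotTail q n (j + 1) = qBallot q n j := by
  obtain ⟨m, hm⟩ := Nat.exists_eq_add_of_le h
  rw [qBallotTail, qBallotTail, qBallot, show 2 * n - j = m by omega,
    show 2 * n + 1 - (j + 1) = m by omega, show 2 * n + 1 - j = m + 1 by omega,
    gaussBinom_succ_succ, gaussBinom_succ_succ]
  ring

lemma qBallotTail_succ_self (q : R) (n : ℕ) : qBallotTail q n (n + 1) = 0 := by
  rw [qBallotTail, gaussBinom_eq_zero_of_lt q (by omega), gaussBinom_eq_zero_of_lt q (by omega),
    mul_zero, sub_zero, mul_zero]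

lemma qBallot_succ_zero (q : R) (n : ℕ) : qBallot q (n + 1) 0 = qBallotTail q n 0 := by
  have hpascal := gaussBinom_add_succ_succ q n (n + 1)
  have hpascal' := gaussBinom_add_succ_succ q (n + 1) n
  have hsymm := gaussBinom_symm_add q n (n + 1)
  simp only [qBallot, qBallotTail, Nat.sub_zero, mul_zero, zero_add, pow_one, pow_zero, one_mul]
  rw [show n + 1 + n = 2 * n + 1 by ring] at hpascal'
  rw [show n + (n + 1) = 2 * n + 1 by ring] at hpascal hsymm
  rw [show 2 * (n + 1) = 2 * n + 1 + 1 by ring]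
  linear_combination hpascal - q * hpascal' + q ^ (n + 1) * hsymm

lemma qBallot_succ_succ (q : R) {n j : ℕ} (h : j ≤ n) :
    qBallot q (n + 1) (j + 1) =
      q ^ (j + 1) * qBallotTail q n (j + 1) + q ^ (2 * (n + 1)) * qBallot q n j := by
  obtain ⟨a, rfl⟩ := Nat.exists_eq_add_of_le h
  have hpascal := gaussBinom_add_succ_succ q (j + a) a
  have hpascal' : q ^ (j + 2) * gaussBinom q (j + a + a + 1) (j + a + 2) =
      q ^ (j + a + 1) * gaussBinom q (j + a + a) (j + a + 1) +
        q ^ (j + 2) * gaussBinom q (j + a + a) (j + a + 2) := by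
    rcases a with - | a
    · simp [gaussBinom_eq_zero_of_lt]
    · have := gaussBinom_add_succ_succ q (j + (a + 1) + 1) a
      rw [show j + (a + 1) + 1 + a = j + (a + 1) + (a + 1) by ring] at this
      rw [this]
      ring
  rw [qBallotTail, qBallot, qBallot, show 2 * (j + a + 1) - (j + 1) = j + a + a + 1 by omega,
    show 2 * (j + a) - j = j + a + a by omega, show 2 * (j + a) + 1 - (j + 1) = j + a + a by omega]
  linear_combination q ^ ((j + a + 2) * (j + 1)) * (hpascal - hpascal')

end Ballot

section Distribution

variable {n : ℕ}

/-- The exponent `maj σ + maj σ⁻¹`. -/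
def majSum (σ : Equiv.Perm (Fin n)) : ℕ :=
  maj σ + maj ⇑σ⁻¹

/-- The number of letters of the word of `σ` to the right of its largest letter. -/
def lettersAfterMax (σ : Equiv.Perm (Fin (n + 1))) : ℕ :=
  (σ⁻¹ (Fin.last n)).rev

lemma lettersAfterMax_insertMax (p : Fin (n + 1)) (σ : Equiv.Perm (Fin n)) :
    lettersAfterMax (insertMax p σ) = p.rev := by
  rw [lettersAfterMax, insertMax_inv_last]

lemma inv_last_le_iff (p : Fin (n + 2)) (σ : Equiv.Perm (Fin (n + 1))) :
    (σ⁻¹ (Fin.last n) : ℕ) ≤ p ↔ (p.rev : ℕ) ≤ lettersAfterMax σ + 1 := by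
  rw [lettersAfterMax, Fin.val_rev, Fin.val_rev]
  omega

lemma majSum_insertMax {p : Fin (n + 2)} {σ : Equiv.Perm (Fin (n + 1))} (hσ : Avoids312 σ)
    (hp : (p.rev : ℕ) ≤ lettersAfterMax σ + 1) :
    majSum (insertMax p σ) = majSum σ +
      if (p.rev : ℕ) = lettersAfterMax σ + 1 then 2 * (n + 1) else (p.rev : ℕ) := by
  have hpos : (p : ℕ) = (σ⁻¹ (Fin.last n) : ℕ) ↔ (p.rev : ℕ) = lettersAfterMax σ + 1 := by
    rw [lettersAfterMax, Fin.val_rev, Fin.val_rev]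
    omega
  rw [← inv_last_le_iff] at hp
  rw [majSum, majSum, maj_insertMax hσ hp, maj_insertMax_inv hp]
  simp only [hpos]
  split_ifs <;> ring

variable {R : Type*} [CommRing R]

lemma sum_majSum_insertMax (q : R) {σ : Equiv.Perm (Fin (n + 1))} (hσ : Avoids312 σ) (f : ℕ → R) :
    ∑ p with Avoids312 (insertMax p σ),
        q ^ majSum (insertMax p σ) * f (lettersAfterMax (insertMax p σ)) =
      q ^ majSum σ * (∑ j ∈ Finset.range (lettersAfterMax σ + 1), q ^ j * f j +
        q ^ (2 * (n + 1)) * f (lettersAfterMax σ + 1)) := by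
  set r := lettersAfterMax σ
  have hrn : r ≤ n := Nat.lt_succ_iff.1 (Fin.is_lt _)
  calc
    _ = ∑ j ∈ Finset.range (r + 2),
          q ^ (majSum σ + if j = r + 1 then 2 * (n + 1) else j) * f j := by
      refine Finset.sum_nbij (fun p => (p.rev : ℕ)) ?_ ?_ ?_ ?_
      · intro p hp
        simp only [Finset.mem_filter, avoids312_insertMax_iff, inv_last_le_iff] at hp
        simp only [Finset.mem_range]
        omega
      · intro p _ p' _ h
        exact Fin.rev_injective (Fin.ext h)
      · intro j hj
        simp only [Finset.coe_range, Set.mem_Iio] at hj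
        refine ⟨Fin.rev ⟨j, by omega⟩, ?_, by simp⟩
        simp only [Finset.coe_filter, Set.mem_ofPred_eq, avoids312_insertMax_iff, inv_last_le_iff,
          Fin.rev_rev]
        exact ⟨Finset.mem_univ _, hσ, by omega⟩
      · intro p hp
        simp only [Finset.mem_filter, avoids312_insertMax_iff, inv_last_le_iff] at hp
        rw [majSum_insertMax hσ hp.2.2, lettersAfterMax_insertMax]
    _ = _ := by
      rw [Finset.sum_range_succ, if_pos rfl, mul_add (q ^ _), Finset.mul_sum, pow_add, mul_assoc]
      congr 1
      refine Finset.sum_congr rfl fun j hj => ?_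
      rw [if_neg (Finset.mem_range.1 hj).ne, pow_add, mul_assoc]

/-- The distribution of `lettersAfterMax` over the `312`-avoiding permutations of `n + 1` letters,
weighted by `q ^ majSum σ` and tested against an arbitrary function `f`. -/
def avoiderSum (q : R) (n : ℕ) (f : ℕ → R) : R :=
  ∑ σ : Equiv.Perm (Fin (n + 1)) with Avoids312 σ, q ^ majSum σ * f (lettersAfterMax σ)

lemma avoiderSum_succ (q : R) (n : ℕ) (f : ℕ → R) :
    avoiderSum q (n + 1) f = avoiderSum q n fun r =>
      ∑ j ∈ Finset.range (r + 1), q ^ j * f j + q ^ (2 * (n + 1)) * f (r + 1) := by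
  rw [avoiderSum, avoiderSum, Finset.sum_filter, ← insertMax_bijective.sum_comp,
    Fintype.sum_prod_type_right, Finset.sum_filter]
  refine Finset.sum_congr rfl fun σ _ => ?_
  split_ifs with hσ
  · rw [← sum_majSum_insertMax q hσ, Finset.sum_filter]
  · simp [avoids312_insertMax_iff, hσ]

end Distribution

section ClosedForm

variable {R : Type*} [CommRing R]

lemma sum_range_sub_mul_sum_range (t c : ℕ → R) (n : ℕ) :
    ∑ r ∈ Finset.range n, (t r - t (r + 1)) * ∑ j ∈ Finset.range (r + 1), c j =
      ∑ j ∈ Finset.range n, (t j - t n) * c j := by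
  induction n with
  | zero => rw [Finset.sum_range_zero, Finset.sum_range_zero]
  | succ n ih =>
    rw [Finset.sum_range_succ, ih, Finset.mul_sum, Finset.sum_range_succ _ n,
      Finset.sum_range_succ _ n, ← add_assoc, ← Finset.sum_add_distrib]
    congr 1
    exact Finset.sum_congr rfl fun j _ => by ring

lemma sum_qBallot_mul_sum_range (q : R) (n : ℕ) (c : ℕ → R) :
    ∑ r ∈ Finset.range (n + 1), qBallot q n r * ∑ j ∈ Finset.range (r + 1), c j =
      ∑ j ∈ Finset.range (n + 1), qBallotTail q n j * c j := by
  have h := sum_range_sub_mul_sum_range (qBallotTail q n) c (n + 1)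
  simp only [qBallotTail_succ_self, sub_zero] at h
  rw [← h]
  refine Finset.sum_congr rfl fun r hr => ?_
  rw [qBallotTail_sub_qBallotTail_succ q (by grind)]

lemma sum_qBallot (q : R) (n : ℕ) :
    ∑ j ∈ Finset.range (n + 1), qBallot q n j = qBallotTail q n 0 := by
  rw [← sub_zero (qBallotTail q n 0), ← qBallotTail_succ_self q n, ← Finset.sum_range_sub']
  refine Finset.sum_congr rfl fun j hj => ?_
  rw [qBallotTail_sub_qBallotTail_succ q (by grind)]

lemma avoiderSum_zero (q : R) (f : ℕ → R) : avoiderSum q 0 f = f 0 := by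
  have hav : Avoids312 (1 : Equiv.Perm (Fin 1)) := fun i j k hij => by omega
  have huniv : (Finset.univ : Finset (Equiv.Perm (Fin (0 + 1)))) = {1} := by decide
  rw [avoiderSum, Finset.sum_filter, huniv, Finset.sum_singleton, if_pos hav]
  simp [majSum, maj_eq_sum_ite, lettersAfterMax]

lemma avoiderSum_eq (q : R) (n : ℕ) (f : ℕ → R) :
    avoiderSum q n f = ∑ j ∈ Finset.range (n + 1), qBallot q n j * f j := by
  induction n generalizing f with
  | zero => simp [avoiderSum_zero, qBallot, gaussBinom]
  | succ n ih =>
    calc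
      avoiderSum q (n + 1) f
      _ = ∑ r ∈ Finset.range (n + 1), qBallot q n r *
            (∑ j ∈ Finset.range (r + 1), q ^ j * f j + q ^ (2 * (n + 1)) * f (r + 1)) := by
        rw [avoiderSum_succ, ih]
      _ = ∑ j ∈ Finset.range (n + 2), qBallotTail q n j * (q ^ j * f j) +
            ∑ r ∈ Finset.range (n + 1), qBallot q n r * (q ^ (2 * (n + 1)) * f (r + 1)) := by
        simp only [mul_add, Finset.sum_add_distrib, sum_qBallot_mul_sum_range,
          Finset.sum_range_succ _ (n + 1), qBallotTail_succ_self, zero_mul, add_zero]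
      _ = qBallotTail q n 0 * f 0 + ∑ j ∈ Finset.range (n + 1),
            (q ^ (j + 1) * qBallotTail q n (j + 1) + q ^ (2 * (n + 1)) * qBallot q n j) *
              f (j + 1) := by
        rw [Finset.sum_range_succ', pow_zero, one_mul, add_right_comm, ← Finset.sum_add_distrib,
          add_comm]
        congr 1
        exact Finset.sum_congr rfl fun j _ => by ring
      _ = ∑ j ∈ Finset.range (n + 2), qBallot q (n + 1) j * f j := by
        rw [Finset.sum_range_succ' _ (n + 1), qBallot_succ_zero, add_comm]
        congr 1
        refine Finset.sum_congr rfl fun j hj => ?_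
        rw [qBallot_succ_succ q (Nat.lt_succ_iff.1 (Finset.mem_range.1 hj))]

theorem sum_avoids312 (q : R) (n : ℕ) :
    ∑ σ : Equiv.Perm (Fin n) with Avoids312 σ, q ^ majSum σ = qCatalan q n := by
  rcases n with - | n
  · have hav : Avoids312 (1 : Equiv.Perm (Fin 0)) := fun i => i.elim0
    rw [Finset.sum_filter, Fintype.sum_subsingleton _ 1, if_pos hav]
    simp [majSum, maj, descents, qCatalan, gaussBinom]
  · have h := avoiderSum_eq q n fun _ => 1
    simp only [avoiderSum, mul_one] at h
    rw [h, sum_qBallot, ← qBallot_succ_zero, qBallot_zero_right]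

-- The instance `Algebra ℤ R` is left arbitrary because the one found on `RatFunc ℚ` is not
-- reducibly equal to the one that every ring carries.
lemma aeval_genFun [Algebra ℤ R] (q : R) (n : ℕ) :
    MvPolynomial.aeval ![q, q] (genFun n) = qCatalan q n := by
  rw [← sum_avoids312, genFun, map_sum]
  refine Finset.sum_congr rfl fun σ _ => ?_
  simp [majSum, pow_add]

end ClosedForm

section RootOfUnity

variable {K : Type*} [Field K] {q : K}

lemma qPochhammer_self_ne_zero {n : ℕ} (hq : ∀ m ∈ Finset.Icc 1 n, q ^ m ≠ 1) :
    qPochhammer q q n ≠ 0 := by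
  refine Finset.prod_ne_zero_iff.2 fun i hi => ?_
  rw [← pow_succ, sub_ne_zero]
  exact (hq (i + 1) (by grind)).symm

lemma qInt_ne_zero {n : ℕ} (hq : q ^ n ≠ 1) : qInt q n ≠ 0 := by
  intro h
  have := qInt_mul_one_sub q n
  rw [h, zero_mul] at this
  exact hq (sub_eq_zero.1 this.symm).symm

lemma ratFunc_X_pow_ne_one {m : ℕ} (hm : m ≠ 0) : (RatFunc.X : RatFunc K) ^ m ≠ 1 := fun h =>
  RatFunc.transcendental_X (K := K) ⟨Polynomial.X ^ m - 1,
    Polynomial.X_pow_sub_C_ne_zero (Nat.pos_of_ne_zero hm) 1, by simp [h]⟩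

end RootOfUnity

end QCatalan

theorem mainTheorem4_general {K : Type*} [Field K] [Algebra ℤ K] {q : K} (n : ℕ)
    (hq : ∀ m ∈ Finset.Icc 1 (n + 1), q ^ m ≠ 1) :
    MvPolynomial.aeval ![q, q] (QCatalan.genFun n) =
      1 / QCatalan.qInt q (n + 1) * QCatalan.qBinom q (2 * n) n := by
  have hpoch : QCatalan.qPochhammer q q n ≠ 0 :=
    QCatalan.qPochhammer_self_ne_zero fun m hm => hq m (by grind)
  have hint : QCatalan.qInt q (n + 1) ≠ 0 := QCatalan.qInt_ne_zero (hq _ (by grind))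
  rw [QCatalan.aeval_genFun, one_div, eq_inv_mul_iff_mul_eq₀ hint,
    QCatalan.qInt_succ_mul_qCatalan, two_mul, QCatalan.qBinom_add_left hpoch hpoch]

theorem mainTheorem4 (n : ℕ) :
    MvPolynomial.aeval ![(RatFunc.X : RatFunc ℚ), RatFunc.X] (QCatalan.genFun n) =
      1 / QCatalan.qInt (RatFunc.X : RatFunc ℚ) (n + 1) *
        QCatalan.qBinom (RatFunc.X : RatFunc ℚ) (2 * n) n :=
  mainTheorem4_general n fun _ hm => QCatalan.ratFunc_X_pow_ne_one (by grind)
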